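/- Let $d,k\ge 2$ be integers and let $\tfrac12<\alpha<k-1$. Let $\mathcal B_d$ be the Poincaré ball, i.e. the open Euclidean unit ball of $\mathbb R^d$ with the Riemannian metric $4|dx|^2/(1-|x|^2)^2$; let $d_H$ be its hyperbolic distance and $o$ its origin. For $n\ge1$ put $R_n=\frac{2}{d-1}\log n$ and $\omega_n=\log\log R_n$ (for the finitely many $n$ with $0<R_n<1$, where the inner logarithm is negative, read $\omega_n=\log|\log R_n|$). Points of the ball $B(o,R_n)=\{x: d_H(o,x)\le R_n\}$ are written in coordinates $(t,\theta)$, where $t=R_n-d_H(o,x)\in[0,R_n]$ and $\theta\in\mathcal A_d=[0,\pi]^{d-2}\times[0,2\pi)$ are the spherical angles of $x$. Let $$\bar\rho_{n,\alpha}(t)=\frac{\sinh^{d-1}(\alpha(R_n-t))}{\int_0^{R_n}\sinh^{d-1}(\alpha s)\,ds}\quad(0\le t\le R_n),\qquad \pi(\theta)=\frac{\prod_{i=1}^{d-2}\sin^{d-i-1}\theta_i}{2\prod_{i=1}^{d-1}\int_0^\pi\sin^{d-i-1}\vartheta\,d\vartheta}\quad(\theta\in\mathcal A_d).$$ For $n\ge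 2$ let $\mathcal P_n=\{X_1,\dots,X_{N_n}\}$, where $X_1,X_2,\dots$ are i.i.d. random points whose coordinates have density $\bar\rho_{n,\alpha}\otimes\pi$, and $N_n$ is Poisson distributed with mean $n$ and independent of $(X_i)_{i\ge1}$. For $u\in(0,R_n)$ let $p$ be the point with coordinates $(u,\mathbf 0)$, where $\mathbf 0=(0,\dots,0)\in\mathcal A_d$, and let $$\mathcal D_{k,n}(u)=\sum_{\substack{(Y_1,\dots,Y_{k-1})\in\mathcal P_n^{k-1}\\ Y_i\ne Y_j\ (i\neq j)}}\mathbf 1\Big\{\max_{1\le i\le k-1}d_H(Y_i,p)\le R_n\Big\}.$$ Then there is a constant $C\in(0,\infty)$, not depending on $n$ and $u$, such that for all $n\ge1$ and all $u\in(0,R_n)$ (for $n=1$ there is no such $u$) the random variable $\mathcal D_{k,n}(u)$ is square integrable and $$\mathrm{Var}\big(\mathcal D_{k,n}(u)\big)\le C\,e^{\alpha(d-1)(2k-3)\omega_n}\,e^{\frac12(d-1)(2k-3)u}.$$ -/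

import Mathlib

open MeasureTheory ProbabilityTheory

noncomputable section

namespace HypStar

/-- The hyperbolic radius `R_n = 2 / (d - 1) * log n`. -/
def radius (d n : ℕ) : ℝ := 2 / ((d : ℝ) - 1) * Real.log n

/-- `ω_n = log log R_n`. -/
def omegaSeq (d n : ℕ) : ℝ := Real.log (Real.log (radius d n))

/-- The hyperbolic distance on the Poincaré ball (the open Euclidean unit ball with the
Riemannian metric `4 |dx|² / (1 - |x|²)²`, of constant curvature `-1`), in closed form:
`cosh d_H(x, y) = 1 + 2 |x - y|² / ((1 - |x|²) (1 - |y|²))`. -/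
def hypDist {d : ℕ} (x y : EuclideanSpace ℝ (Fin d)) : ℝ :=
  Real.arcosh (1 + 2 * ‖x - y‖ ^ 2 / ((1 - ‖x‖ ^ 2) * (1 - ‖y‖ ^ 2)))

/-- The set `𝒜_d = [0, π]^(d-2) × [0, 2π)` of angular coordinates. -/
def angleSet (d : ℕ) : Set (Fin (d - 1) → ℝ) :=
  {θ | ∀ i : Fin (d - 1), 0 ≤ θ i ∧
    if (i : ℕ) < d - 2 then θ i ≤ Real.pi else θ i < 2 * Real.pi}

/-- The point of the Euclidean unit sphere with spherical coordinates `θ`: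
`(cos θ₁, sin θ₁ cos θ₂, …, sin θ₁ ⋯ sin θ_{d-2} cos θ_{d-1}, sin θ₁ ⋯ sin θ_{d-1})`. -/
def direction (d : ℕ) (θ : Fin (d - 1) → ℝ) : EuclideanSpace ℝ (Fin d) :=
  WithLp.toLp 2 fun i : Fin d =>
    (∏ j : Fin (d - 1), if (j : ℕ) < (i : ℕ) then Real.sin (θ j) else 1) *
      (if h : (i : ℕ) < d - 1 then Real.cos (θ ⟨i, h⟩) else 1)

/-- The point `(t, θ)` of the hyperbolic ball `B(o, R)`: it lies in direction `θ` at hyperbolic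
distance `R - t` from the origin, that is, at Euclidean distance `tanh ((R - t) / 2)`. -/
def polarPoint (d : ℕ) (R t : ℝ) (θ : Fin (d - 1) → ℝ) : EuclideanSpace ℝ (Fin d) :=
  Real.tanh ((R - t) / 2) • direction d θ

theorem norm_direction {d : ℕ} (hd : 1 ≤ d) (θ : Fin (d - 1) → ℝ) : ‖direction d θ‖ = 1 := by
  obtain ⟨m, rfl⟩ : ∃ m, d = m + 1 := ⟨d - 1, by omega⟩
  have key : ∀ k : ℕ, k ≤ m → (∑ i : Fin (m + 1), if (i : ℕ) < k then
      (direction (m + 1) θ i) ^ 2 else 0) =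
      1 - ∏ j : Fin m, (if (j : ℕ) < k then Real.sin (θ j) else 1) ^ 2 := by
    intro k
    induction k with
    | zero => simp
    | succ k ih =>
      intro hk
      have e1 : ∀ i : Fin (m + 1), (if (i : ℕ) < k + 1 then (direction (m + 1) θ i) ^ 2 else 0) =
          (if (i : ℕ) < k then (direction (m + 1) θ i) ^ 2 else 0) +
          (if i = ⟨k, by omega⟩ then (direction (m + 1) θ i) ^ 2 else 0) := by
        intro i
        rcases lt_trichotomy (i : ℕ) k with h | h | h
        · simp [h, Fin.ext_iff, h.ne, Nat.lt_succ_of_lt h]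
        · simp [h, Fin.ext_iff]
        · simp [Fin.ext_iff, h.ne', not_lt.2 h.le, not_lt.2 (Nat.succ_le_of_lt h)]
      have e2 : ∀ j : Fin m, (if (j : ℕ) < k + 1 then Real.sin (θ j) else 1) ^ 2 =
          (if (j : ℕ) < k then Real.sin (θ j) else 1) ^ 2 *
          (if j = ⟨k, by omega⟩ then Real.sin (θ j) ^ 2 else 1) := by
        intro j
        rcases lt_trichotomy (j : ℕ) k with h | h | h
        · simp [h, Fin.ext_iff, h.ne, Nat.lt_succ_of_lt h]
        · simp [h, Fin.ext_iff]
        · simp [Fin.ext_iff, h.ne', not_lt.2 h.le, not_lt.2 (Nat.succ_le_of_lt h)]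
      simp_rw [e1, e2]
      rw [Finset.sum_add_distrib, Finset.prod_mul_distrib, ih (by omega)]
      have hk' : k < m := by omega
      have e3 : (∏ j : Fin m, if (j : ℕ) < k then Real.sin (θ j) ^ 2 else 1) =
          (∏ j : Fin m, if (j : ℕ) < k then Real.sin (θ j) else 1) ^ 2 := by
        rw [← Finset.prod_pow]
        exact Finset.prod_congr rfl fun j _ => by split_ifs <;> simp
      simp [direction, hk', mul_pow, Real.cos_sq', e3]
      ring
  have h := key m le_rfl
  have : ‖direction (m + 1) θ‖ ^ 2 = 1 := by
    rw [EuclideanSpace.norm_sq_eq, Fin.sum_univ_castSucc]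
    rw [Fin.sum_univ_castSucc] at h
    simp at h
    simp [h]
    simp [direction, Finset.prod_pow]
  nlinarith [norm_nonneg (direction (m + 1) θ)]

/-- The coordinate `t` of `polarPoint d R t θ` is `R` minus its hyperbolic distance to the origin. -/
theorem hypDist_polarPoint_zero {d : ℕ} (hd : 1 ≤ d) {R t : ℝ} (ht : t ≤ R)
    (θ : Fin (d - 1) → ℝ) : hypDist (polarPoint d R t θ) 0 = R - t := by
  have h0 : 0 < Real.cosh ((R - t) / 2) := Real.cosh_pos _
  have h1 := Real.cosh_sq ((R - t) / 2)
  have h2 : Real.cosh (R - t) = 2 * Real.sinh ((R - t) / 2) ^ 2 + 1 := by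
    have := Real.cosh_two_mul ((R - t) / 2)
    rw [show 2 * ((R - t) / 2) = R - t by ring] at this
    linarith
  have h3 : 1 + 2 * Real.tanh ((R - t) / 2) ^ 2 / (1 - Real.tanh ((R - t) / 2) ^ 2) =
      Real.cosh (R - t) := by
    have h4 : 1 - Real.tanh ((R - t) / 2) ^ 2 = 1 / Real.cosh ((R - t) / 2) ^ 2 := by
      rw [Real.tanh_eq_sinh_div_cosh]; field_simp; linarith
    rw [h4, h2, Real.tanh_eq_sinh_div_cosh]; field_simp; ring
  have h5 : ‖polarPoint d R t θ‖ ^ 2 = Real.tanh ((R - t) / 2) ^ 2 := by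
    rw [polarPoint, norm_smul, norm_direction hd, mul_one, Real.norm_eq_abs, sq_abs]
  rw [hypDist, sub_zero, norm_zero, h5]
  simp only [ne_eq, OfNat.ofNat_ne_zero, not_false_eq_true, zero_pow, sub_zero, mul_one]
  rw [h3, Real.arcosh_cosh (by linarith)]

/-- The radial density `sinh^(d-1) (α (R_n - t)) / ∫_0^{R_n} sinh^(d-1) (α s) ds`
(the radial coordinate `t` is measured from the boundary of the ball). -/
def radialDensity (d : ℕ) (α : ℝ) (n : ℕ) (t : ℝ) : ℝ :=
  Real.sinh (α * (radius d n - t)) ^ (d - 1) /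
    ∫ s in (0 : ℝ)..radius d n, Real.sinh (α * s) ^ (d - 1)

/-- The angular density: with the angles numbered from `0`, the exponent of `sin θ_j` is
`d - 2 - j`, which is `0` for the last angle `j = d - 2`. -/
def angularDensity (d : ℕ) (θ : Fin (d - 1) → ℝ) : ℝ :=
  (∏ j : Fin (d - 1), Real.sin (θ j) ^ (d - 2 - (j : ℕ))) /
    (2 * ∏ j : Fin (d - 1), ∫ φ in (0 : ℝ)..Real.pi, Real.sin φ ^ (d - 2 - (j : ℕ)))

/-- The law on `[0, R_n]` with density `radialDensity`. -/
def radialLaw (d : ℕ) (α : ℝ) (n : ℕ) : Measure ℝ :=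
  (volume.restrict (Set.Icc 0 (radius d n))).withDensity
    fun t => ENNReal.ofReal (radialDensity d α n t)

/-- The law on `𝒜_d` with density `angularDensity`. -/
def angularLaw (d : ℕ) : Measure (Fin (d - 1) → ℝ) :=
  (volume.restrict (angleSet d)).withDensity
    fun θ => ENNReal.ofReal (angularDensity d θ)

/-- The law, on the Poincaré ball, of a random point whose coordinates `(t, θ)` have the product
of the radial and the angular law. -/
def vertexLaw (d : ℕ) (α : ℝ) (n : ℕ) : Measure (EuclideanSpace ℝ (Fin d)) :=
  ((radialLaw d α n).prod (angularLaw d)).map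
    fun z => polarPoint d (radius d n) z.1 z.2

/-- The data of the Poisson point process: `X 0, X 1, …` are i.i.d. random points with law
`vertexLaw`, and `N` is Poisson distributed with mean `n` and independent of the sequence. -/
structure IsPoissonData (d : ℕ) (α : ℝ) (n : ℕ) {Ω : Type*} [MeasurableSpace Ω] (P : Measure Ω)
    (X : ℕ → Ω → EuclideanSpace ℝ (Fin d)) (N : Ω → ℕ) : Prop where
  measurable_X : ∀ i, Measurable (X i)
  map_X : ∀ i, P.map (X i) = vertexLaw d α n
  iIndepFun_X : iIndepFun X P
  measurable_N : Measurable N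
  map_N : P.map N = poissonMeasure (n : NNReal)
  indepFun_N_X : IndepFun N (fun ω i => X i ω) P

open scoped Classical in
/-- The point set `{X 0, …, X (N - 1)}`. -/
def points {d : ℕ} {Ω : Type*} (X : ℕ → Ω → EuclideanSpace ℝ (Fin d)) (N : Ω → ℕ) (ω : Ω) :
    Finset (EuclideanSpace ℝ (Fin d)) :=
  (Finset.range (N ω)).image fun i => X i ω

open scoped Classical in
/-- Ordered `m`-tuples of pairwise distinct elements of `S`. -/
def distinctTuples {E : Type*} (m : ℕ) (S : Finset E) : Finset (Fin m → E) :=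
  (Fintype.piFinset fun _ => S).filter Function.Injective

open scoped Classical in
/-- The star shape count centred at `p`, for the point configuration `S`: the number of ordered
`(k - 1)`-tuples of distinct points of `S` all within hyperbolic distance `R` of `p`. -/
def starCount {d : ℕ} (k : ℕ) (R : ℝ) (S : Finset (EuclideanSpace ℝ (Fin d)))
    (p : EuclideanSpace ℝ (Fin d)) : ℝ :=
  ∑ Y ∈ distinctTuples (k - 1) S, if ∀ i, hypDist (Y i) p ≤ R then 1 else 0

/-- The random variable `D_{k,n}(u)`: the star shape count of the points `X 0, …, X (N - 1)`
centred at the point with radial coordinate `u` and all angular coordinates `0`. -/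
def starCountAt {d : ℕ} (k n : ℕ) {Ω : Type*} (X : ℕ → Ω → EuclideanSpace ℝ (Fin d))
    (N : Ω → ℕ) (u : ℝ) (ω : Ω) : ℝ :=
  starCount k (radius d n) (points X N ω) (polarPoint d (radius d n) u 0)

end HypStar

end

/-!
Almost surely the sampled points are distinct, since their law has no atoms. Then the star count is
the falling factorial `(Z)_m`, with `m = k - 1`, of the number `Z` of points in the hyperbolic ball
of radius `R_n` around `p` (`starCountAt_eq_of_injective`). The factorial moments of `Z` are those of
a Poisson variable, `E (Z)_a = λ ^ a`, where `λ` is `n` times the mass of that ball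
(`lintegral_descFactorial_hitCount_poisson`). Expanding `(Z)_m ^ 2` in falling factorials of orders
`m, …, 2 m` and subtracting `(E (Z)_m) ^ 2 = λ ^ (2 m)`, which cancels the top term, gives
`Var (Z)_m ≤ c max(1, λ) ^ (2 m - 1)` (`memLp_and_variance_descFactorial_le`), and
`2 m - 1 = 2 k - 3`.

It remains to bound `max(1, λ)` by a multiple of `e^{α(d-1)ω_n} e^{(d-1)u/2}`
(`exists_intensity_le`). By the hyperbolic law of cosines, a point `(t, θ)` within distance `R_n` of
`(u, 0)` satisfies `sin² (θ₁ / 2) ≤ c² e^{t + u - R_n}` (`exists_sin_sq_le`), an event of angular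
probability at most a multiple of `e^{(d-1)(t + u - R_n)/2}` (`exists_angularLaw_le`), while the
radial density is at most a multiple of `e^{-α(d-1)t}` (`exists_radialDensity_le`). As `α > 1/2`,
integrating over `t` leaves a multiple of `e^{(d-1)(u - R_n)/2}` (`exists_vertexLaw_ball_le`), and
`n = e^{(d-1)R_n/2}`.
-/

namespace HypStar

open scoped ENNReal NNReal

/-! ### Falling factorials and Poisson moments -/

theorem succ_descFactorial_succ_eq_add (z b : ℕ) :
    (z + 1).descFactorial (b + 1) = z.descFactorial (b + 1) + (b + 1) * z.descFactorial b := by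
  rw [Nat.succ_descFactorial_succ, Nat.descFactorial_succ]
  rcases lt_or_ge z b with h | h
  · simp [Nat.descFactorial_eq_zero_iff_lt.2 h]
  · rw [← add_mul]
    congr 1
    omega

/-- One factor `(z)_m` is expanded by Vandermonde's identity for `z = (z - m) + m`, and
`(z)_m (z - m)_i = (z)_{m + i}`. -/
theorem descFactorial_sq (z m : ℕ) :
    z.descFactorial m ^ 2 = ∑ i ∈ Finset.range (m + 1),
      m.choose i * m.descFactorial (m - i) * z.descFactorial (m + i) := by
  rcases lt_or_ge z m with h | h
  · rw [Nat.descFactorial_eq_zero_iff_lt.2 h]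
    rw [zero_pow two_ne_zero]
    refine (Finset.sum_eq_zero fun i _ => ?_).symm
    rw [Nat.descFactorial_eq_zero_iff_lt.2 (h.trans_le (Nat.le_add_right m i)), mul_zero]
  · have h1 : z.descFactorial m = ∑ i ∈ Finset.range (m + 1),
        m.choose i * m.descFactorial (m - i) * (z - m).descFactorial i := by
      conv_lhs => rw [← Nat.sub_add_cancel h]
      rw [Nat.descFactorial_eq_factorial_mul_choose, Nat.add_choose_eq,
        Finset.Nat.sum_antidiagonal_eq_sum_range_succ_mk, Finset.mul_sum]
      refine Finset.sum_congr rfl fun i hi => ?_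
      have hi' : i ≤ m := Nat.lt_succ_iff.1 (Finset.mem_range.1 hi)
      have h2 := Nat.factorial_mul_descFactorial (Nat.sub_le m i)
      rw [Nat.sub_sub_self hi'] at h2
      rw [Nat.choose_symm hi', Nat.descFactorial_eq_factorial_mul_choose (z - m) i, ← h2]
      ring
    rw [sq]
    nth_rewrite 1 [h1]
    rw [Finset.sum_mul]
    refine Finset.sum_congr rfl fun i _ => ?_
    have h3 := Nat.descFactorial_mul_descFactorial (n := z) (Nat.le_add_right m i)
    rw [Nat.add_sub_cancel_left] at h3
    rw [mul_assoc, h3]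

theorem lintegral_descFactorial_poissonMeasure (r : ℝ≥0) (a : ℕ) :
    ∫⁻ j, (j.descFactorial a : ℝ≥0∞) ∂poissonMeasure r = (r : ℝ≥0∞) ^ a := by
  set f : ℕ → ℝ := fun j => Real.exp (-r) * r ^ j / (j.factorial : ℝ) * (j.descFactorial a : ℝ)
  have hf : HasSum f ((r : ℝ) ^ a) := by
    have h0 : ∑ i ∈ Finset.range a, f i = 0 := Finset.sum_eq_zero fun i hi => by
      simp [f, Nat.descFactorial_eq_zero_iff_lt.2 (Finset.mem_range.1 hi)]
    have h1 := (hasSum_one_poissonMeasure r).mul_left ((r : ℝ) ^ a)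
    have h2 : (fun i => (r : ℝ) ^ a * (Real.exp (-r) * r ^ i / (i.factorial : ℝ))) =
        fun i => f (i + a) := by
      ext i
      have h3 := Nat.factorial_mul_descFactorial (Nat.le_add_left a i)
      rw [Nat.add_sub_cancel] at h3
      have h4 : ((i + a).factorial : ℝ) = i.factorial * (i + a).descFactorial a := by
        exact_mod_cast h3.symm
      have h5 : ((i + a).descFactorial a : ℝ) ≠ 0 := by
        exact_mod_cast (Nat.descFactorial_pos.2 (Nat.le_add_left a i)).ne'
      have h6 : (i.factorial : ℝ) ≠ 0 := by positivity
      simp only [f]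
      rw [h4, pow_add]
      field_simp
    rw [h2] at h1
    have := (hasSum_nat_add_iff a).1 h1
    simpa [h0] using this
  have h0 : ∀ j, 0 ≤ f j := fun j => by positivity
  rw [poissonMeasure, lintegral_sum_measure]
  have h1 : ∀ j : ℕ, ∫⁻ i, (i.descFactorial a : ℝ≥0∞) ∂(ENNReal.ofReal
      (Real.exp (-r) * r ^ j / (j.factorial : ℝ)) • Measure.dirac j) = ENNReal.ofReal (f j) := by
    intro j
    rw [lintegral_smul_measure, lintegral_dirac, smul_eq_mul, ENNReal.ofReal_mul (by positivity),
      ENNReal.ofReal_natCast]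
  simp_rw [h1]
  rw [← ENNReal.ofReal_tsum_of_nonneg h0 hf.summable, hf.tsum_eq,
    ENNReal.ofReal_pow r.coe_nonneg, ENNReal.ofReal_coe_nnreal]

/-! ### Sampled points in a set -/

open scoped Classical in
/-- The number of indices `i < j` with `x i ∈ B`. -/
noncomputable def hitCount {E : Type*} (B : Set E) (j : ℕ) (x : ℕ → E) : ℕ :=
  ∑ i ∈ Finset.range j, if x i ∈ B then 1 else 0

theorem measurable_hitCount {E : Type*} [MeasurableSpace E] {B : Set E} (hB : MeasurableSet B)
    (j : ℕ) : Measurable (hitCount B j) := by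
  unfold hitCount
  refine Finset.measurable_sum _ fun i _ => ?_
  exact Measurable.ite (measurable_pi_apply i hB) measurable_const measurable_const

theorem measurable_hitCount_comp {Ω E : Type*} [MeasurableSpace Ω] [MeasurableSpace E]
    {X : ℕ → Ω → E} {N : Ω → ℕ} {B : Set E} (hB : MeasurableSet B) (hX : ∀ i, Measurable (X i))
    (hN : Measurable N) : Measurable fun ω => hitCount B (N ω) fun i => X i ω := by
  have h1 : Measurable fun z : (ℕ → E) × ℕ => hitCount B z.2 z.1 :=
    measurable_from_prod_countable_left fun j => measurable_hitCount hB j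
  have hXm : Measurable fun ω i => X i ω := measurable_pi_iff.2 hX
  exact h1.comp (hXm.prodMk hN)

section Moments

variable {Ω E : Type*} [MeasurableSpace Ω] [MeasurableSpace E] {P : Measure Ω}
  [IsProbabilityMeasure P] {X : ℕ → Ω → E} {B : Set E} {q : ℝ≥0∞}

/-- The factorial moments of a binomial variable. The induction on the number of trials matches
the recursion `(j + 1)_{b + 1} = (j)_{b + 1} + (b + 1) (j)_b`. -/
theorem lintegral_descFactorial_hitCount (hX : ∀ i, Measurable (X i)) (hind : iIndepFun X P)
    (hB : MeasurableSet B) (hq : ∀ i, P (X i ⁻¹' B) = q) (j a : ℕ) :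
    ∫⁻ ω, ((hitCount B j fun i => X i ω).descFactorial a : ℝ≥0∞) ∂P =
      (j.descFactorial a : ℝ≥0∞) * q ^ a := by
  classical
  have hXm : Measurable fun ω i => X i ω := measurable_pi_iff.2 hX
  have hm : ∀ j, Measurable fun ω => hitCount B j fun i => X i ω :=
    fun j => (measurable_hitCount hB j).comp hXm
  induction j generalizing a with
  | zero => cases a <;> simp [hitCount]
  | succ j ih =>
    cases a with
    | zero => simp
    | succ b =>
      set Y : ℕ → Ω → ℕ := fun i ω => if X i ω ∈ B then 1 else 0
      have hY : ∀ i, Measurable (Y i) := fun i =>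
        Measurable.ite (hX i hB) measurable_const measurable_const
      have hYind : iIndepFun Y P := hind.comp (fun _ x => if x ∈ B then 1 else 0) fun _ =>
        Measurable.ite hB measurable_const measurable_const
      have hZ : (∑ i ∈ Finset.range j, Y i) = fun ω => hitCount B j fun i => X i ω := by
        ext ω
        simp [hitCount, Y]
      have h1 := hYind.indepFun_sum_range_succ hY j
      rw [hZ] at h1
      have h2 : ∀ ω, ((hitCount B (j + 1) fun i => X i ω).descFactorial (b + 1) : ℝ≥0∞) =
          ((hitCount B j fun i => X i ω).descFactorial (b + 1) : ℝ≥0∞) +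
          (b + 1) * (((hitCount B j fun i => X i ω).descFactorial b : ℝ≥0∞) * (Y j ω : ℝ≥0∞)) := by
        intro ω
        by_cases h : X j ω ∈ B
        · have : hitCount B (j + 1) (fun i => X i ω) = hitCount B j (fun i => X i ω) + 1 := by
            rw [hitCount, Finset.sum_range_succ]
            simp [hitCount, h]
          rw [this, succ_descFactorial_succ_eq_add]
          simp [Y, h]
        · have : hitCount B (j + 1) (fun i => X i ω) = hitCount B j (fun i => X i ω) := by
            rw [hitCount, Finset.sum_range_succ]
            simp [hitCount, h]
          rw [this]
          simp [Y, h]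
      have h3 : ∫⁻ ω, ((hitCount B j fun i => X i ω).descFactorial b : ℝ≥0∞) * (Y j ω : ℝ≥0∞) ∂P =
          (j.descFactorial b : ℝ≥0∞) * q ^ b * q := by
        have h4 := lintegral_mul_eq_lintegral_mul_lintegral_of_indepFun (μ := P)
          (f := fun ω => ((hitCount B j fun i => X i ω).descFactorial b : ℝ≥0∞))
          (g := fun ω => (Y j ω : ℝ≥0∞))
          ((measurable_of_countable fun z : ℕ => (z.descFactorial b : ℝ≥0∞)).comp (hm j))
          ((measurable_of_countable fun z : ℕ => (z : ℝ≥0∞)).comp (hY j))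
          (h1.comp (measurable_of_countable fun z : ℕ => (z.descFactorial b : ℝ≥0∞))
            (measurable_of_countable fun z : ℕ => (z : ℝ≥0∞)))
        simp only [Pi.mul_apply] at h4
        rw [h4, ih b]
        congr 1
        rw [← hq j, ← lintegral_indicator_one (hX j hB)]
        refine lintegral_congr fun ω => ?_
        by_cases h : X j ω ∈ B <;> simp [Y, h]
      have hmeas : Measurable fun ω =>
          ((hitCount B j fun i => X i ω).descFactorial (b + 1) : ℝ≥0∞) :=
        (measurable_of_countable fun z : ℕ => (z.descFactorial (b + 1) : ℝ≥0∞)).comp (hm j)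
      have hmeas' : Measurable fun ω =>
          ((hitCount B j fun i => X i ω).descFactorial b : ℝ≥0∞) * (Y j ω : ℝ≥0∞) :=
        ((measurable_of_countable fun z : ℕ => (z.descFactorial b : ℝ≥0∞)).comp (hm j)).mul
          ((measurable_of_countable fun z : ℕ => (z : ℝ≥0∞)).comp (hY j))
      simp_rw [h2]
      rw [lintegral_add_left hmeas, lintegral_const_mul _ hmeas', ih (b + 1), h3,
        succ_descFactorial_succ_eq_add]
      push_cast
      ring

/-- Poisson thinning on the level of factorial moments: with a Poisson number of trials, the number
of hits has the factorial moments of a Poisson variable with mean `r * q`. -/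
theorem lintegral_descFactorial_hitCount_poisson {N : Ω → ℕ} {r : ℝ≥0}
    (hX : ∀ i, Measurable (X i)) (hind : iIndepFun X P) (hN : Measurable N)
    (hNlaw : P.map N = poissonMeasure r) (hNX : IndepFun N (fun ω i => X i ω) P)
    (hB : MeasurableSet B) (hq : ∀ i, P (X i ⁻¹' B) = q) (a : ℕ) :
    ∫⁻ ω, ((hitCount B (N ω) fun i => X i ω).descFactorial a : ℝ≥0∞) ∂P =
      ((r : ℝ≥0∞) * q) ^ a := by
  classical
  have hXm : Measurable fun ω i => X i ω := measurable_pi_iff.2 hX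
  have hdF : Measurable fun z : ℕ => (z.descFactorial a : ℝ≥0∞) := measurable_of_countable _
  have hI : ∀ j : ℕ, Measurable fun z : ℕ => if z = j then (1 : ℝ≥0∞) else 0 :=
    fun j => measurable_of_countable _
  have h1 : ∀ ω, ((hitCount B (N ω) fun i => X i ω).descFactorial a : ℝ≥0∞) =
      ∑' j : ℕ, (if N ω = j then 1 else 0) *
        ((hitCount B j fun i => X i ω).descFactorial a : ℝ≥0∞) := by
    intro ω
    rw [tsum_eq_single (N ω) fun j hj => by simp [hj.symm]]
    simp
  have h2 : ∀ j : ℕ, ∫⁻ ω, (if N ω = j then 1 else 0) *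
        ((hitCount B j fun i => X i ω).descFactorial a : ℝ≥0∞) ∂P =
      (∫⁻ ω, (if N ω = j then 1 else 0) ∂P) * ((j.descFactorial a : ℝ≥0∞) * q ^ a) := by
    intro j
    rw [← lintegral_descFactorial_hitCount hX hind hB hq j a]
    exact lintegral_mul_eq_lintegral_mul_lintegral_of_indepFun
      ((hI j).comp hN) (hdF.comp ((measurable_hitCount hB j).comp hXm))
      (hNX.comp (hI j) (hdF.comp (measurable_hitCount hB j)))
  simp_rw [h1]
  have hm1 : ∀ j : ℕ, Measurable fun ω => (if N ω = j then (1 : ℝ≥0∞) else 0) *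
      ((hitCount B j fun i => X i ω).descFactorial a : ℝ≥0∞) := fun j =>
    ((hI j).comp hN).mul (hdF.comp ((measurable_hitCount hB j).comp hXm))
  have hm2 : ∀ j : ℕ, Measurable fun ω => (if N ω = j then (1 : ℝ≥0∞) else 0) *
      ((N ω).descFactorial a : ℝ≥0∞) := fun j => ((hI j).comp hN).mul (hdF.comp hN)
  rw [lintegral_tsum fun j => (hm1 j).aemeasurable]
  simp_rw [h2]
  have h3 : ∀ j : ℕ, (∫⁻ ω, (if N ω = j then 1 else 0) ∂P) *
      ((j.descFactorial a : ℝ≥0∞) * q ^ a) =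
      (∫⁻ ω, (if N ω = j then 1 else 0) * ((N ω).descFactorial a : ℝ≥0∞) ∂P) * q ^ a := by
    intro j
    have hIN : Measurable fun ω => if N ω = j then (1 : ℝ≥0∞) else 0 := (hI j).comp hN
    rw [← mul_assoc, ← lintegral_mul_const _ hIN]
    congr 1
    refine lintegral_congr fun ω => ?_
    by_cases h : N ω = j <;> simp [h]
  simp_rw [h3]
  rw [ENNReal.tsum_mul_right, ← lintegral_tsum fun j => (hm2 j).aemeasurable, mul_pow,
    ← lintegral_descFactorial_poissonMeasure r a, ← hNlaw,
    lintegral_map hdF hN]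
  congr 1
  refine lintegral_congr fun ω => ?_
  rw [tsum_eq_single (N ω) fun j hj => by simp [hj.symm]]
  simp

/-- Expanding `(z)_m ^ 2` in falling factorials of order `m, …, 2 m`, the term of order `2 m`
contributes exactly the square of the mean, so that the variance has order at most `2 m - 1` in the
intensity. -/
theorem memLp_and_variance_descFactorial_le {Z : Ω → ℕ} (hZ : Measurable Z) {l : ℝ≥0}
    (hmom : ∀ a : ℕ, ∫⁻ ω, ((Z ω).descFactorial a : ℝ≥0∞) ∂P = (l : ℝ≥0∞) ^ a) {m : ℕ}
    {L : ℝ} (hl : (l : ℝ) ≤ L) (hL : 1 ≤ L) :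
    MemLp (fun ω => ((Z ω).descFactorial m : ℝ)) 2 P ∧
      variance (fun ω => ((Z ω).descFactorial m : ℝ)) P ≤
        (∑ i ∈ Finset.range m, m.choose i * m.descFactorial (m - i) : ℕ) * L ^ (2 * m - 1) := by
  have hmeas : ∀ a : ℕ, Measurable fun ω => ((Z ω).descFactorial a : ℝ) := fun a =>
    (measurable_of_countable fun z : ℕ => (z.descFactorial a : ℝ)).comp hZ
  have hlin : ∀ a : ℕ, ∫⁻ ω, ENNReal.ofReal ((Z ω).descFactorial a : ℝ) ∂P = (l : ℝ≥0∞) ^ a := by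
    intro a
    simp_rw [ENNReal.ofReal_natCast]
    exact hmom a
  have hint : ∀ a : ℕ, Integrable (fun ω => ((Z ω).descFactorial a : ℝ)) P := fun a =>
    (lintegral_ofReal_ne_top_iff_integrable (hmeas a).aestronglyMeasurable
      (Filter.Eventually.of_forall fun ω => by positivity)).1 (by rw [hlin]; simp)
  have hval : ∀ a : ℕ, ∫ ω, ((Z ω).descFactorial a : ℝ) ∂P = (l : ℝ) ^ a := by
    intro a
    rw [integral_eq_lintegral_of_nonneg_ae (Filter.Eventually.of_forall fun ω => by positivity)
      (hmeas a).aestronglyMeasurable, hlin]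
    simp
  have hsq : ∀ ω, ((Z ω).descFactorial m : ℝ) ^ 2 = ∑ i ∈ Finset.range (m + 1),
      (m.choose i * m.descFactorial (m - i) : ℕ) * ((Z ω).descFactorial (m + i) : ℝ) := by
    intro ω
    exact_mod_cast descFactorial_sq (Z ω) m
  have hsqint : Integrable (fun ω => ((Z ω).descFactorial m : ℝ) ^ 2) P := by
    simp_rw [hsq]
    exact integrable_finsetSum _ fun i _ => (hint _).const_mul _
  have hLp := (memLp_two_iff_integrable_sq (hmeas m).aestronglyMeasurable).2 hsqint
  refine ⟨hLp, ?_⟩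
  rw [variance_eq_sub hLp]
  simp only [Pi.pow_apply]
  simp_rw [hsq]
  rw [integral_finsetSum _ fun i _ => (hint _).const_mul _, hval]
  simp_rw [integral_const_mul, hval]
  rw [Finset.sum_range_succ]
  have htop : ((m.choose m * m.descFactorial (m - m) : ℕ) : ℝ) * (l : ℝ) ^ (m + m) =
      ((l : ℝ) ^ m) ^ 2 := by
    simp
    ring
  rw [htop, add_sub_cancel_right, Nat.cast_sum, Finset.sum_mul]
  refine Finset.sum_le_sum fun i hi => ?_
  have hi' := Finset.mem_range.1 hi
  gcongr
  calc (l : ℝ) ^ (m + i) ≤ L ^ (m + i) := by gcongr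
    _ ≤ L ^ (2 * m - 1) := pow_le_pow_right₀ hL (by omega)

end Moments

/-! ### The star count as a falling factorial -/

open scoped Classical in
theorem card_distinctTuples {E : Type*} (m : ℕ) (T : Finset E) :
    (distinctTuples m T).card = T.card.descFactorial m := by
  have h := Fintype.card_embedding_eq (α := Fin m) (β := T)
  rw [Fintype.card_fin, Fintype.card_coe] at h
  rw [← h, ← Finset.card_univ]
  symm
  refine Finset.card_bij (fun f _ i => (f i : E)) ?_ ?_ ?_
  · intro f _
    simp only [distinctTuples, Finset.mem_filter, Fintype.mem_piFinset]
    exact ⟨fun i => (f i).2, Subtype.val_injective.comp f.injective⟩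
  · intro f _ g _ hfg
    ext i
    exact congrFun hfg i
  · intro y hy
    simp only [distinctTuples, Finset.mem_filter, Fintype.mem_piFinset] at hy
    exact ⟨⟨fun i => ⟨y i, hy.1 i⟩, fun i j hij => hy.2 (congrArg Subtype.val hij)⟩,
      Finset.mem_univ _, rfl⟩

open scoped Classical in
theorem starCount_eq_descFactorial {d : ℕ} (k : ℕ) (R : ℝ)
    (S : Finset (EuclideanSpace ℝ (Fin d))) (p : EuclideanSpace ℝ (Fin d)) :
    starCount k R S p = ((S.filter fun x => hypDist x p ≤ R).card.descFactorial (k - 1) : ℝ) := by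
  rw [starCount, Finset.sum_boole, ← card_distinctTuples]
  congr 2
  ext Y
  simp only [distinctTuples, Finset.mem_filter, Fintype.mem_piFinset]
  constructor
  · rintro ⟨⟨h1, h2⟩, h3⟩
    exact ⟨fun i => ⟨h1 i, h3 i⟩, h2⟩
  · rintro ⟨h1, h2⟩
    exact ⟨⟨fun i => (h1 i).1, h2⟩, fun i => (h1 i).2⟩

/-- On the event that the sampled points are distinct, passing from the sequence to the point set
loses no multiplicities. -/
theorem starCountAt_eq_of_injective {d : ℕ} (k n : ℕ) {Ω : Type*} [MeasurableSpace Ω]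
    (X : ℕ → Ω → EuclideanSpace ℝ (Fin d)) (N : Ω → ℕ) (u : ℝ) (ω : Ω)
    (hinj : Function.Injective fun i => X i ω) :
    starCountAt k n X N u ω =
      ((hitCount {x | hypDist x (polarPoint d (radius d n) u 0) ≤ radius d n} (N ω)
        fun i => X i ω).descFactorial (k - 1) : ℝ) := by
  classical
  rw [starCountAt, starCount_eq_descFactorial, points, Finset.filter_image,
    Finset.card_image_of_injective _ hinj, hitCount, Finset.sum_boole]
  simp

theorem ae_injective_of_iIndepFun {Ω E : Type*} [MeasurableSpace Ω] [MeasurableSpace E]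
    [MeasurableSingletonClass E] [MeasurableEq E] {P : Measure Ω} [IsProbabilityMeasure P]
    {X : ℕ → Ω → E} (hX : ∀ i, Measurable (X i)) (hind : iIndepFun X P)
    (hatom : ∀ i x, P.map (X i) {x} = 0) : ∀ᵐ ω ∂P, Function.Injective fun i => X i ω := by
  have h : ∀ i j, i ≠ j → ∀ᵐ ω ∂P, X i ω ≠ X j ω := by
    intro i j hij
    have : IsProbabilityMeasure (P.map (X i)) := Measure.isProbabilityMeasure_map (hX i).aemeasurable
    have : IsProbabilityMeasure (P.map (X j)) := Measure.isProbabilityMeasure_map (hX j).aemeasurable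
    have h1 := (indepFun_iff_map_prod_eq_prod_map_map (hX i).aemeasurable
      (hX j).aemeasurable).1 (hind.indepFun hij)
    have h2 : ((P.map (X i)).prod (P.map (X j))) (Set.diagonal E) = 0 := by
      rw [Measure.prod_apply measurableSet_diagonal, lintegral_eq_zero_of_ae_eq_zero]
      refine Filter.Eventually.of_forall fun x => ?_
      have : Prod.mk x ⁻¹' Set.diagonal E = {x} := by
        ext y
        simp [eq_comm]
      simp [this, hatom j x]
    rw [← h1, Measure.map_apply ((hX i).prodMk (hX j)) measurableSet_diagonal] at h2
    exact measure_eq_zero_iff_ae_notMem.1 h2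
  have h' : ∀ᵐ ω ∂P, ∀ i j, i ≠ j → X i ω ≠ X j ω :=
    ae_all_iff.2 fun i => ae_all_iff.2 fun j => by
      by_cases hij : i = j
      · simp [hij]
      · filter_upwards [h i j hij] with ω hω _ using hω
  filter_upwards [h'] with ω hω i j hij
  by_contra hne
  exact hω i j hne hij

/-! ### Hyperbolic distance in polar coordinates -/

theorem inner_direction_zero {d : ℕ} (hd : 2 ≤ d) (θ : Fin (d - 1) → ℝ) :
    inner ℝ (direction d θ) (direction d 0) = Real.cos (θ ⟨0, by omega⟩) := by
  have h : direction d 0 = EuclideanSpace.single ⟨0, by omega⟩ (1 : ℝ) := by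
    ext i
    by_cases hi : (i : ℕ) = 0
    · have : i = ⟨0, by omega⟩ := Fin.ext hi
      rw [this]
      simp [direction]
    · have h0 : (∏ j : Fin (d - 1), if (j : ℕ) < (i : ℕ) then
          Real.sin ((0 : Fin (d - 1) → ℝ) j) else 1) = 0 :=
        Finset.prod_eq_zero (Finset.mem_univ ⟨0, by omega⟩) (by simp [Nat.pos_of_ne_zero hi])
      have hi' : i ≠ ⟨0, by omega⟩ := fun h => hi (congrArg Fin.val h)
      simp only [direction]
      rw [h0, zero_mul]
      simp [hi']
  rw [h, EuclideanSpace.inner_single_right]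
  have h1 : 0 < d - 1 := by omega
  simp [direction, h1]

theorem one_sub_tanh_sq (x : ℝ) : 1 - Real.tanh x ^ 2 = 1 / Real.cosh x ^ 2 := by
  have h0 : 0 < Real.cosh x := Real.cosh_pos _
  have h1 := Real.cosh_sq x
  rw [Real.tanh_eq_sinh_div_cosh]
  field_simp
  linarith

/-- This is the hyperbolic law of cosines with the nonnegative term `cosh (a - b)` dropped. -/
theorem two_mul_sinh_mul_sinh_mul_sin_sq_le {d : ℕ} (hd : 2 ≤ d) {R t u : ℝ} (hR : 0 ≤ R)
    (ht : t ≤ R) (hu : u ≤ R) {θ : Fin (d - 1) → ℝ}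
    (h : hypDist (polarPoint d R t θ) (polarPoint d R u 0) ≤ R) :
    2 * Real.sinh (R - t) * Real.sinh (R - u) * Real.sin (θ ⟨0, by omega⟩ / 2) ^ 2 ≤
      Real.cosh R := by
  set φ := θ ⟨0, by omega⟩ with hφ
  set a := (R - t) / 2 with ha
  set b := (R - u) / 2 with hb
  have ha0 : 0 ≤ a := by rw [ha]; linarith
  have hb0 : 0 ≤ b := by rw [hb]; linarith
  have hca : 0 < Real.cosh a := Real.cosh_pos _
  have hcb : 0 < Real.cosh b := Real.cosh_pos _
  have hsa : 0 ≤ Real.sinh a := Real.sinh_nonneg_iff.2 ha0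
  have hsb : 0 ≤ Real.sinh b := Real.sinh_nonneg_iff.2 hb0
  have hnorm : ∀ s (η : Fin (d - 1) → ℝ), ‖polarPoint d R s η‖ ^ 2 =
      Real.tanh ((R - s) / 2) ^ 2 := fun s η => by
    rw [polarPoint, norm_smul, norm_direction (by omega), mul_one, Real.norm_eq_abs, sq_abs]
  have hsub : ‖polarPoint d R t θ - polarPoint d R u 0‖ ^ 2 =
      Real.tanh a ^ 2 - 2 * (Real.tanh a * Real.tanh b * Real.cos φ) + Real.tanh b ^ 2 := by
    rw [norm_sub_sq_real, hnorm, hnorm, polarPoint, polarPoint, inner_smul_left,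
      inner_smul_right, inner_direction_zero hd]
    simp only [← ha, ← hb, ← hφ, conj_trivial]
    ring
  rw [hypDist, hsub, hnorm, hnorm, ← ha, ← hb, one_sub_tanh_sq, one_sub_tanh_sq] at h
  have hcos : Real.cos φ = 1 - 2 * Real.sin (φ / 2) ^ 2 := by
    have h1 := Real.cos_two_mul (φ / 2)
    have h2 := Real.sin_sq_add_cos_sq (φ / 2)
    rw [mul_div_cancel₀ _ (two_ne_zero' ℝ)] at h1
    linarith
  set q := (1 : ℝ) + 2 * (Real.tanh a ^ 2 - 2 * (Real.tanh a * Real.tanh b * Real.cos φ) +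
    Real.tanh b ^ 2) / (1 / Real.cosh a ^ 2 * (1 / Real.cosh b ^ 2)) with hq
  have hqeq : q = 1 + 2 * (Real.sinh a * Real.cosh b - Real.sinh b * Real.cosh a) ^ 2 +
      2 * (2 * Real.sinh a * Real.cosh a) * (2 * Real.sinh b * Real.cosh b) *
        Real.sin (φ / 2) ^ 2 := by
    rw [hq, hcos, Real.tanh_eq_sinh_div_cosh, Real.tanh_eq_sinh_div_cosh]
    field_simp
    ring
  have hRa : Real.sinh (R - t) = 2 * Real.sinh a * Real.cosh a := by
    rw [← Real.sinh_two_mul]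
    congr 1
    rw [ha]
    ring
  have hRb : Real.sinh (R - u) = 2 * Real.sinh b * Real.cosh b := by
    rw [← Real.sinh_two_mul]
    congr 1
    rw [hb]
    ring
  have hge : 1 + 2 * Real.sinh (R - t) * Real.sinh (R - u) * Real.sin (φ / 2) ^ 2 ≤ q := by
    rw [hqeq, hRa, hRb]
    nlinarith [sq_nonneg (Real.sinh a * Real.cosh b - Real.sinh b * Real.cosh a)]
  have hnn : 0 ≤ 2 * Real.sinh (R - t) * Real.sinh (R - u) * Real.sin (φ / 2) ^ 2 := by
    rw [hRa, hRb]
    positivity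
  have hq1 : 1 ≤ q := by linarith
  have hle : q ≤ Real.cosh R := by
    rw [← Real.cosh_arcosh hq1, Real.cosh_le_cosh, abs_of_nonneg (Real.arcosh_nonneg hq1),
      abs_of_nonneg hR]
    exact h
  linarith

/-- The hyperbolic sine is comparable to the exponential away from `0`. -/
theorem exp_mul_le_sinh {δ x : ℝ} (hx : δ ≤ x) :
    (1 - Real.exp (-2 * δ)) / 2 * Real.exp x ≤ Real.sinh x := by
  have h : Real.exp (-x) ≤ Real.exp (-2 * δ) * Real.exp x := by
    rw [← Real.exp_add]
    exact Real.exp_le_exp.2 (by linarith)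
  rw [Real.sinh_eq]
  linarith

/-- The points of the ball of radius `R` around `(u, 0)` at radial coordinate `t` lie in a cone whose
aperture is of order `e^{(t + u - R) / 2}`. -/
theorem exists_sin_sq_le (d : ℕ) (hd : 2 ≤ d) : ∃ c : ℝ, 0 < c ∧ ∀ R t u : ℝ, 0 ≤ t → t ≤ R →
    0 ≤ u → u ≤ R → ∀ θ : Fin (d - 1) → ℝ,
      hypDist (polarPoint d R t θ) (polarPoint d R u 0) ≤ R →
      Real.sin (θ ⟨0, by omega⟩ / 2) ^ 2 ≤ (c * Real.exp ((t + u - R) / 2)) ^ 2 := by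
  set κ : ℝ := (1 - Real.exp (-2 * 1)) / 2 with hκ
  have hκ0 : 0 < κ := by
    have : Real.exp (-2 * 1) < 1 := Real.exp_lt_one_iff.2 (by norm_num)
    exact half_pos (sub_pos.2 this)
  have hc : 0 < Real.exp 1 + 1 / (2 * κ ^ 2) := by positivity
  refine ⟨√(Real.exp 1 + 1 / (2 * κ ^ 2)), Real.sqrt_pos.2 hc, ?_⟩
  intro R t u ht htR hu huR θ h
  rw [mul_pow, Real.sq_sqrt hc.le, ← Real.exp_nat_mul]
  rw [show ((2 : ℕ) : ℝ) * ((t + u - R) / 2) = t + u - R by push_cast; ring]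
  -- For `t + u ≤ R - 1` both `R - t` and `R - u` are at least `1`, where `sinh` is comparable to
  -- `exp`; otherwise the right-hand side exceeds `1`.
  by_cases h1 : t + u - R ≤ -1
  · have h2 := two_mul_sinh_mul_sinh_mul_sin_sq_le hd (ht.trans htR) htR huR h
    have ha : κ * Real.exp (R - t) ≤ Real.sinh (R - t) := exp_mul_le_sinh (by linarith)
    have hb : κ * Real.exp (R - u) ≤ Real.sinh (R - u) := exp_mul_le_sinh (by linarith)
    have hR : Real.cosh R ≤ Real.exp R := by
      rw [Real.cosh_eq]
      have : Real.exp (-R) ≤ Real.exp R := Real.exp_le_exp.2 (by linarith)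
      linarith
    set S := Real.sin (θ ⟨0, by omega⟩ / 2) ^ 2
    have hS : 0 ≤ S := sq_nonneg _
    have h3 : 2 * (κ * Real.exp (R - t)) * (κ * Real.exp (R - u)) * S ≤ Real.exp R := by
      refine le_trans ?_ (h2.trans hR)
      gcongr
    have h4 : Real.exp R = Real.exp (R - t) * Real.exp (R - u) * Real.exp (t + u - R) := by
      rw [← Real.exp_add, ← Real.exp_add]
      congr 1
      ring
    rw [h4] at h3
    have h5 : 2 * κ ^ 2 * S ≤ Real.exp (t + u - R) := by
      refine le_of_mul_le_mul_left ?_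
        (mul_pos (Real.exp_pos (R - t)) (Real.exp_pos (R - u)))
      linarith
    have h6 : S ≤ 1 / (2 * κ ^ 2) * Real.exp (t + u - R) := by
      rw [div_mul_eq_mul_div, one_mul, le_div_iff₀ (by positivity)]
      linarith
    have h7 : 0 < Real.exp 1 * Real.exp (t + u - R) := by positivity
    linarith
  · have h2 : 1 ≤ Real.exp 1 * Real.exp (t + u - R) := by
      rw [← Real.exp_add]
      exact Real.one_le_exp (by linarith)
    have h3 : 0 < 1 / (2 * κ ^ 2) * Real.exp (t + u - R) := by positivity
    have h4 := Real.sin_sq_le_one (θ ⟨0, by omega⟩ / 2)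
    linarith

/-! ### The angular and the radial law -/

theorem measurableSet_angleSet (d : ℕ) : MeasurableSet (angleSet d) := by
  rw [angleSet, Set.ofPred_forall]
  refine MeasurableSet.iInter fun i => ?_
  by_cases h : (i : ℕ) < d - 2
  · simp only [h, if_true]
    exact (measurableSet_le measurable_const (measurable_pi_apply i)).inter
      (measurableSet_le (measurable_pi_apply i) measurable_const)
  · simp only [h, if_false]
    exact (measurableSet_le measurable_const (measurable_pi_apply i)).inter
      (measurableSet_lt (measurable_pi_apply i) measurable_const)

theorem le_two_pi_of_mem_angleSet {d : ℕ} {θ : Fin (d - 1) → ℝ} (h : θ ∈ angleSet d)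
    (i : Fin (d - 1)) : θ i ≤ 2 * Real.pi := by
  have h1 := (h i).2
  split_ifs at h1
  · linarith [Real.pi_pos]
  · exact h1.le

/-- For `d = 2` the angle runs over a full circle, whence the second interval. -/
theorem mem_Icc_union_of_sin_sq_le {x r : ℝ} (hx : 0 ≤ x) (hx' : x ≤ 2 * Real.pi) (hr : 0 ≤ r)
    (h : Real.sin (x / 2) ^ 2 ≤ r ^ 2) :
    x ∈ Set.Icc 0 (Real.pi * r) ∪ Set.Icc (2 * Real.pi - Real.pi * r) (2 * Real.pi) := by
  have hpi := Real.pi_pos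
  have h1 : Real.sin (x / 2) ≤ r := le_of_sq_le_sq h hr
  rcases le_total x Real.pi with h2 | h2
  · left
    have h3 := Real.mul_le_sin (x := x / 2) (by linarith) (by linarith)
    have h4 : x / Real.pi ≤ r := by
      calc x / Real.pi = 2 / Real.pi * (x / 2) := by ring
        _ ≤ r := h3.trans h1
    rw [div_le_iff₀ hpi] at h4
    exact ⟨hx, by linarith⟩
  · right
    have h3 := Real.mul_le_sin (x := Real.pi - x / 2) (by linarith) (by linarith)
    rw [Real.sin_pi_sub] at h3
    have h4 : (2 * Real.pi - x) / Real.pi ≤ r := by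
      calc (2 * Real.pi - x) / Real.pi = 2 / Real.pi * (Real.pi - x / 2) := by ring
        _ ≤ r := h3.trans h1
    rw [div_le_iff₀ hpi] at h4
    exact ⟨by linarith, hx'⟩

/-- The density is bounded by its factor `sin^(d-2) θ₁`, and `|sin θ₁| ≤ 2 |sin (θ₁ / 2)|`. -/
theorem exists_angularDensity_le (d : ℕ) (hd : 2 ≤ d) : ∃ K : ℝ, 0 < K ∧
    ∀ (r : ℝ) (θ : Fin (d - 1) → ℝ), 0 ≤ r → Real.sin (θ ⟨0, by omega⟩ / 2) ^ 2 ≤ r ^ 2 →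
      angularDensity d θ ≤ K * r ^ (d - 2) := by
  set D : ℝ := 2 * ∏ j : Fin (d - 1), ∫ φ in (0 : ℝ)..Real.pi, Real.sin φ ^ (d - 2 - (j : ℕ))
    with hD
  have hD0 : 0 < D := mul_pos two_pos (Finset.prod_pos fun j _ => integral_sin_pow_pos _)
  refine ⟨2 ^ (d - 2) / D, by positivity, fun r θ hr h => ?_⟩
  rw [angularDensity, ← hD, div_mul_eq_mul_div]
  refine div_le_div_of_nonneg_right ?_ hD0.le
  refine (le_abs_self _).trans ?_
  rw [Finset.abs_prod, ← Finset.mul_prod_erase _ _ (Finset.mem_univ ⟨0, by omega⟩), ← mul_pow]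
  have h1 : ∏ j ∈ Finset.univ.erase (⟨0, by omega⟩ : Fin (d - 1)),
      |Real.sin (θ j) ^ (d - 2 - (j : ℕ))| ≤ 1 :=
    Finset.prod_le_one (fun j _ => abs_nonneg _) fun j _ => by
      rw [abs_pow]
      exact pow_le_one₀ (abs_nonneg _) (Real.abs_sin_le_one _)
  have h2 : |Real.sin (θ ⟨0, by omega⟩)| ≤ 2 * r := by
    have h3 : |Real.sin (θ ⟨0, by omega⟩ / 2)| ≤ r := abs_le_of_sq_le_sq h hr
    have h4 := Real.sin_two_mul (θ ⟨0, by omega⟩ / 2)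
    rw [mul_div_cancel₀ _ (two_ne_zero' ℝ)] at h4
    rw [h4, abs_mul, abs_mul, abs_two]
    have h5 := Real.abs_cos_le_one (θ ⟨0, by omega⟩ / 2)
    nlinarith [abs_nonneg (Real.sin (θ ⟨0, by omega⟩ / 2)),
      abs_nonneg (Real.cos (θ ⟨0, by omega⟩ / 2))]
  rw [abs_pow]
  refine (mul_le_of_le_one_right (by positivity) h1).trans ?_
  exact pow_le_pow_left₀ (abs_nonneg _) h2 _

/-- A cone of half-angle of order `r` around the axis has angular probability of order `r^(d-1)`: one
power of `r` comes from the length of the range of `θ₁`, the other `d - 2` from the density. -/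
theorem exists_angularLaw_le (d : ℕ) (hd : 2 ≤ d) : ∃ K : ℝ, 0 < K ∧ ∀ r : ℝ, 0 ≤ r →
    angularLaw d {θ | Real.sin (θ ⟨0, by omega⟩ / 2) ^ 2 ≤ r ^ 2} ≤
      ENNReal.ofReal (K * r ^ (d - 1)) := by
  obtain ⟨K, hK, hdens⟩ := exists_angularDensity_le d hd
  have hpi := Real.pi_pos
  refine ⟨K * (2 * Real.pi * (2 * Real.pi) ^ (d - 2)), by positivity, fun r hr => ?_⟩
  set i0 : Fin (d - 1) := ⟨0, by omega⟩
  set S : Set (Fin (d - 1) → ℝ) := {θ | Real.sin (θ i0 / 2) ^ 2 ≤ r ^ 2}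
  have hS : MeasurableSet S := measurableSet_le (by fun_prop) measurable_const
  rw [angularLaw, withDensity_apply _ hS, Measure.restrict_restrict hS]
  have hvol : volume (S ∩ angleSet d) ≤
      ENNReal.ofReal (2 * Real.pi * r * (2 * Real.pi) ^ (d - 2)) := by
    set I : Fin (d - 1) → Set ℝ := fun j => if j = i0 then
      Set.Icc 0 (Real.pi * r) ∪ Set.Icc (2 * Real.pi - Real.pi * r) (2 * Real.pi)
      else Set.Icc 0 (2 * Real.pi)
    have hsub : S ∩ angleSet d ⊆ Set.univ.pi I := by
      rintro θ ⟨h1, h2⟩ j -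
      simp only [I]
      split_ifs with hj
      · subst hj
        exact mem_Icc_union_of_sin_sq_le (h2 i0).1 (le_two_pi_of_mem_angleSet h2 i0) hr h1
      · exact ⟨(h2 j).1, le_two_pi_of_mem_angleSet h2 j⟩
    refine (measure_mono hsub).trans ?_
    rw [volume_pi_pi, ← Finset.mul_prod_erase _ _ (Finset.mem_univ i0)]
    have h1 : volume (I i0) ≤ ENNReal.ofReal (2 * Real.pi * r) := by
      simp only [I, if_true]
      refine (measure_union_le _ _).trans ?_
      rw [Real.volume_Icc, Real.volume_Icc, ← ENNReal.ofReal_add (by nlinarith) (by nlinarith)]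
      exact ENNReal.ofReal_le_ofReal (by linarith)
    have h2 : ∏ j ∈ Finset.univ.erase i0, volume (I j) =
        ENNReal.ofReal ((2 * Real.pi) ^ (d - 2)) := by
      rw [Finset.prod_congr rfl fun j hj => show volume (I j) = ENNReal.ofReal (2 * Real.pi) by
        simp [I, Finset.ne_of_mem_erase hj], Finset.prod_const,
        Finset.card_erase_of_mem (Finset.mem_univ i0), Finset.card_univ, Fintype.card_fin,
        ENNReal.ofReal_pow (by positivity)]
      rfl
    rw [h2, ENNReal.ofReal_mul (by positivity)]
    gcongr
  calc ∫⁻ θ in S ∩ angleSet d, ENNReal.ofReal (angularDensity d θ)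
      ≤ ∫⁻ _ in S ∩ angleSet d, ENNReal.ofReal (K * r ^ (d - 2)) :=
        setLIntegral_mono' (hS.inter (measurableSet_angleSet d)) fun θ hθ =>
          ENNReal.ofReal_le_ofReal (hdens r θ hr hθ.1)
    _ = ENNReal.ofReal (K * r ^ (d - 2)) * volume (S ∩ angleSet d) := setLIntegral_const _ _
    _ ≤ ENNReal.ofReal (K * r ^ (d - 2)) *
        ENNReal.ofReal (2 * Real.pi * r * (2 * Real.pi) ^ (d - 2)) := by gcongr
    _ = ENNReal.ofReal (K * (2 * Real.pi * (2 * Real.pi) ^ (d - 2)) * r ^ (d - 1)) := by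
        rw [← ENNReal.ofReal_mul (by positivity)]
        congr 1
        rw [show d - 1 = (d - 2) + 1 by omega, pow_succ r]
        ring

/-- The restriction to `R_n ≥ 2` keeps the normalizing integral away from `0`: it is bounded
below by the contribution of the last unit interval. -/
theorem exists_radialDensity_le (d : ℕ) {α : ℝ} (hα : 0 < α) : ∃ K : ℝ, 0 < K ∧
    ∀ (n : ℕ) (t : ℝ), 2 ≤ radius d n → t ≤ radius d n →
      radialDensity d α n t ≤ K * Real.exp (-(α * t)) ^ (d - 1) := by
  set κ : ℝ := (1 - Real.exp (-2 * α)) / 2 with hκ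
  have hκ0 : 0 < κ := by
    have : Real.exp (-2 * α) < 1 := Real.exp_lt_one_iff.2 (by linarith)
    linarith
  refine ⟨(Real.exp α / κ) ^ (d - 1), by positivity, fun n t hR ht => ?_⟩
  set R := radius d n
  have hint : ∀ a b, IntervalIntegrable (fun s => Real.sinh (α * s) ^ (d - 1)) volume a b :=
    fun a b => (by fun_prop : Continuous fun s => Real.sinh (α * s) ^ (d - 1)).intervalIntegrable a b
  have hlow : (κ * Real.exp (α * (R - 1))) ^ (d - 1) ≤
      ∫ s in (0 : ℝ)..R, Real.sinh (α * s) ^ (d - 1) := by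
    rw [← intervalIntegral.integral_add_adjacent_intervals (hint 0 (R - 1)) (hint (R - 1) R)]
    have h1 : 0 ≤ ∫ s in (0 : ℝ)..(R - 1), Real.sinh (α * s) ^ (d - 1) :=
      intervalIntegral.integral_nonneg (by linarith) fun s hs =>
        pow_nonneg (Real.sinh_nonneg_iff.2 (mul_nonneg hα.le hs.1)) _
    have h2 : ∫ _ in (R - 1)..R, (κ * Real.exp (α * (R - 1))) ^ (d - 1) ≤
        ∫ s in (R - 1)..R, Real.sinh (α * s) ^ (d - 1) := by
      refine intervalIntegral.integral_mono_on (by linarith) (by simp) (hint _ _) fun s hs => ?_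
      refine pow_le_pow_left₀ (by positivity) ?_ _
      refine (exp_mul_le_sinh (by nlinarith)).trans (Real.sinh_le_sinh.2 ?_)
      exact mul_le_mul_of_nonneg_left hs.1 hα.le
    rw [intervalIntegral.integral_const] at h2
    simp only [sub_sub_cancel, one_smul] at h2
    linarith
  have hup : Real.sinh (α * (R - t)) ^ (d - 1) ≤ Real.exp (α * (R - t)) ^ (d - 1) := by
    refine pow_le_pow_left₀ (Real.sinh_nonneg_iff.2 (mul_nonneg hα.le (by linarith))) ?_ _
    rw [Real.sinh_eq]
    linarith [Real.exp_pos (α * (R - t)), Real.exp_pos (-(α * (R - t)))]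
  calc radialDensity d α n t ≤
      Real.exp (α * (R - t)) ^ (d - 1) / (κ * Real.exp (α * (R - 1))) ^ (d - 1) := by
        rw [radialDensity]
        gcongr
    _ = (Real.exp α / κ) ^ (d - 1) * Real.exp (-(α * t)) ^ (d - 1) := by
        rw [← div_pow, ← mul_pow]
        congr 1
        rw [show α * (R - t) = α + -(α * t) + α * (R - 1) by ring, Real.exp_add _ (α * (R - 1)),
          Real.exp_add α, mul_div_mul_right _ _ (Real.exp_ne_zero _), div_mul_eq_mul_div]

/-! ### The law of a point -/

theorem measurable_hypDist {d : ℕ} (p : EuclideanSpace ℝ (Fin d)) :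
    Measurable fun x => hypDist x p := by
  unfold hypDist Real.arcosh
  fun_prop

theorem measurable_polarPoint (d : ℕ) (R : ℝ) :
    Measurable fun z : ℝ × (Fin (d - 1) → ℝ) => polarPoint d R z.1 z.2 := by
  have h1 : Measurable fun θ : Fin (d - 1) → ℝ => direction d θ := by
    unfold direction
    refine (WithLp.measurable_toLp 2 _).comp (measurable_pi_iff.2 fun i => ?_)
    refine Measurable.mul (Finset.measurable_prod _ fun j _ => ?_) ?_
    · split_ifs <;> fun_prop
    · split_ifs <;> fun_prop
  have h2 : Measurable fun z : ℝ × (Fin (d - 1) → ℝ) => Real.tanh ((R - z.1) / 2) := by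
    simp_rw [Real.tanh_eq_sinh_div_cosh]
    fun_prop
  exact h2.smul (h1.comp measurable_snd)

theorem measurable_radialDensity (d : ℕ) (α : ℝ) (n : ℕ) : Measurable (radialDensity d α n) := by
  unfold radialDensity
  fun_prop

instance (d : ℕ) : SFinite (angularLaw d) := by
  unfold angularLaw
  infer_instance

instance (d : ℕ) (α : ℝ) (n : ℕ) : SFinite (radialLaw d α n) := by
  unfold radialLaw
  infer_instance

/-- The point `x` determines its radial coordinate, and the radial law has a density. -/
theorem vertexLaw_singleton {d : ℕ} (hd : 1 ≤ d) (α : ℝ) (n : ℕ)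
    (x : EuclideanSpace ℝ (Fin d)) : vertexLaw d α n {x} = 0 := by
  rw [vertexLaw, Measure.map_apply (measurable_polarPoint d _) (measurableSet_singleton x),
    Measure.prod_apply (measurable_polarPoint d _ (measurableSet_singleton x)), radialLaw]
  rw [lintegral_eq_zero_of_ae_eq_zero]
  refine (withDensity_absolutelyContinuous _ _).ae_le ?_
  have h1 : ∀ᵐ t ∂(volume.restrict (Set.Icc 0 (radius d n))), t ∈ Set.Icc 0 (radius d n) :=
    ae_restrict_mem measurableSet_Icc
  have h2 : ∀ᵐ t ∂(volume.restrict (Set.Icc 0 (radius d n))), t ≠ radius d n - hypDist x 0 :=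
    Measure.ae_ne _ _
  filter_upwards [h1, h2] with t ht hne
  have : Prod.mk t ⁻¹' ((fun z : ℝ × (Fin (d - 1) → ℝ) =>
      polarPoint d (radius d n) z.1 z.2) ⁻¹' {x}) = ∅ := by
    ext θ
    simp only [Set.mem_preimage, Set.mem_singleton_iff, Set.mem_empty_iff_false, iff_false]
    rintro rfl
    rw [hypDist_polarPoint_zero hd ht.2] at hne
    exact hne (by ring)
  simp [this]

theorem exists_vertexLaw_ball_le (d : ℕ) (hd : 2 ≤ d) {α : ℝ} (hα : 1 / 2 < α) :
    ∃ K : ℝ, 0 < K ∧ ∀ (n : ℕ) (u : ℝ), 2 ≤ radius d n → 0 ≤ u → u ≤ radius d n →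
      vertexLaw d α n {x | hypDist x (polarPoint d (radius d n) u 0) ≤ radius d n} ≤
        ENNReal.ofReal (K * Real.exp ((u - radius d n) / 2) ^ (d - 1)) := by
  obtain ⟨c, hc, hsin⟩ := exists_sin_sq_le d hd
  obtain ⟨K₁, hK₁, hang⟩ := exists_angularLaw_le d hd
  obtain ⟨K₂, hK₂, hrad⟩ := exists_radialDensity_le d (α := α) (by linarith)
  set β : ℝ := (α - 1 / 2) * ((d - 1 : ℕ) : ℝ) with hβ
  have hd1 : (0 : ℝ) < ((d - 1 : ℕ) : ℝ) := by
    exact_mod_cast (by omega : 0 < d - 1)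
  have hβ0 : 0 < β := mul_pos (by linarith) hd1
  -- Any half-line containing `[0, R]` serves; an open one fits `integral_exp_mul_Ioi`.
  set J : ℝ := ∫ t in Set.Ioi (-1 : ℝ), Real.exp (-β * t) with hJ
  have hJ0 : 0 < J := by
    rw [hJ, integral_exp_mul_Ioi (by linarith)]
    have := Real.exp_pos (-β * -1)
    rw [neg_div_neg_eq]
    positivity
  have hJl : ∫⁻ t in Set.Ioi (-1 : ℝ), ENNReal.ofReal (Real.exp (-β * t)) = ENNReal.ofReal J := by
    rw [hJ, ofReal_integral_eq_lintegral_ofReal (integrableOn_exp_mul_Ioi (by linarith) _)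
      (Filter.Eventually.of_forall fun t => (Real.exp_pos _).le)]
  refine ⟨K₂ * (K₁ * c ^ (d - 1)) * J, by positivity, fun n u hR hu huR => ?_⟩
  set R := radius d n
  set B : Set (EuclideanSpace ℝ (Fin d)) := {x | hypDist x (polarPoint d R u 0) ≤ R}
  have hB : MeasurableSet B := measurableSet_le (measurable_hypDist _) measurable_const
  have hA := measurable_polarPoint d R hB
  rw [vertexLaw, Measure.map_apply (measurable_polarPoint d _) hB, Measure.prod_apply hA,
    radialLaw, lintegral_withDensity_eq_lintegral_mul _
      (measurable_radialDensity d α n).ennreal_ofReal (measurable_measure_prodMk_left hA)]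
  set M : ℝ := K₂ * (K₁ * c ^ (d - 1)) * Real.exp ((u - R) / 2) ^ (d - 1) with hM
  have hM0 : 0 < M := by positivity
  calc ∫⁻ t in Set.Icc 0 R, ENNReal.ofReal (radialDensity d α n t) *
        angularLaw d (Prod.mk t ⁻¹' ((fun z : ℝ × (Fin (d - 1) → ℝ) =>
          polarPoint d R z.1 z.2) ⁻¹' B))
      ≤ ∫⁻ t in Set.Icc 0 R, ENNReal.ofReal M * ENNReal.ofReal (Real.exp (-β * t)) := by
        refine setLIntegral_mono' measurableSet_Icc fun t ht => ?_
        have h1 : angularLaw d (Prod.mk t ⁻¹' ((fun z : ℝ × (Fin (d - 1) → ℝ) =>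
            polarPoint d R z.1 z.2) ⁻¹' B)) ≤
            ENNReal.ofReal (K₁ * (c * Real.exp ((t + u - R) / 2)) ^ (d - 1)) :=
          (measure_mono fun θ hθ => hsin R t u ht.1 ht.2 hu huR θ hθ).trans
            (hang _ (by positivity))
        refine (mul_le_mul' (ENNReal.ofReal_le_ofReal (hrad n t hR ht.2)) h1).trans ?_
        rw [← ENNReal.ofReal_mul (by positivity), ← ENNReal.ofReal_mul hM0.le]
        refine le_of_eq (congrArg _ ?_)
        have h2 : Real.exp (-β * t) =
            Real.exp (-(α * t)) ^ (d - 1) * Real.exp (t / 2) ^ (d - 1) := by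
          rw [← mul_pow, ← Real.exp_add, ← Real.exp_nat_mul]
          congr 1
          rw [hβ]
          ring
        have h3 : Real.exp ((t + u - R) / 2) = Real.exp (t / 2) * Real.exp ((u - R) / 2) := by
          rw [← Real.exp_add]
          congr 1
          ring
        rw [h2, h3, hM, mul_pow c, mul_pow (Real.exp _)]
        ring
    _ ≤ ∫⁻ t in Set.Ioi (-1 : ℝ), ENNReal.ofReal M * ENNReal.ofReal (Real.exp (-β * t)) :=
        lintegral_mono_set fun t ht => lt_of_lt_of_le (by norm_num) ht.1
    _ = ENNReal.ofReal (K₂ * (K₁ * c ^ (d - 1)) * J * Real.exp ((u - R) / 2) ^ (d - 1)) := by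
        rw [lintegral_const_mul _ (by fun_prop), hJl, ← ENNReal.ofReal_mul hM0.le]
        congr 1
        rw [hM]
        ring

/-! ### The mean number of points in the ball -/

theorem tendsto_radius_atTop {d : ℕ} (hd : 2 ≤ d) :
    Filter.Tendsto (radius d) Filter.atTop Filter.atTop := by
  have hd' : (2 : ℝ) ≤ d := by exact_mod_cast hd
  have h : (0 : ℝ) < 2 / ((d : ℝ) - 1) := div_pos two_pos (by linarith)
  exact (Real.tendsto_log_atTop.comp tendsto_natCast_atTop_atTop).const_mul_atTop h

theorem exp_radius_half_pow {d n : ℕ} (hd : 2 ≤ d) (hn : 1 ≤ n) :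
    Real.exp (radius d n / 2) ^ (d - 1) = n := by
  have hd' : (2 : ℝ) ≤ d := by exact_mod_cast hd
  have hn' : (0 : ℝ) < n := by exact_mod_cast hn
  have h : (d : ℝ) - 1 ≠ 0 := by linarith
  rw [← Real.exp_nat_mul, Nat.cast_sub (by omega), radius, Nat.cast_one]
  rw [show ((d : ℝ) - 1) * (2 / ((d : ℝ) - 1) * Real.log n / 2) = Real.log n by field_simp]
  exact Real.exp_log hn'

/-- As soon as `R_n ≥ e` one has `ω_n ≥ 0`, and the estimate of the ball's mass gives a bound by
`e^{(d-1)u/2}` alone. For the remaining `n` the mean is at most `n`, and the constant absorbs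
`e^{-α(d-1)ω_n}`, whatever the sign of `ω_n`. -/
theorem exists_intensity_le (d : ℕ) (hd : 2 ≤ d) {α : ℝ} (hα : 1 / 2 < α) :
    ∃ A : ℝ, 0 < A ∧ ∀ n : ℕ, 1 ≤ n → vertexLaw d α n Set.univ ≤ 1 →
      ∀ u : ℝ, 0 < u → u < radius d n →
        max 1 ((n : ℝ) * (vertexLaw d α n
          {x | hypDist x (polarPoint d (radius d n) u 0) ≤ radius d n}).toReal) ≤
        A * (Real.exp (α * ((d : ℝ) - 1) * omegaSeq d n) *
          Real.exp (1 / 2 * ((d : ℝ) - 1) * u)) := by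
  have hd' : (2 : ℝ) ≤ d := by exact_mod_cast hd
  obtain ⟨K, hK, hball⟩ := exists_vertexLaw_ball_le d hd hα
  obtain ⟨n₀, hn₀⟩ := Filter.eventually_atTop.1
    ((tendsto_radius_atTop hd).eventually_ge_atTop (Real.exp 1))
  set F : ℕ → ℝ := fun n => ((n : ℝ) + 1) * Real.exp (-(α * ((d : ℝ) - 1) * omegaSeq d n))
  have hF : ∀ n, 0 ≤ F n := fun n => by positivity
  have hFs : 0 ≤ ∑ i ∈ Finset.range n₀, F i := Finset.sum_nonneg fun i _ => hF i
  refine ⟨1 + K + ∑ i ∈ Finset.range n₀, F i, by positivity, fun n hn hprob u hu huR => ?_⟩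
  set B := {x | hypDist x (polarPoint d (radius d n) u 0) ≤ radius d n}
  have hu1 : 1 ≤ Real.exp (1 / 2 * ((d : ℝ) - 1) * u) :=
    Real.one_le_exp (mul_nonneg (by linarith) hu.le)
  rcases lt_or_ge n n₀ with h | h
  · have hq : (vertexLaw d α n B).toReal ≤ 1 :=
      ENNReal.toReal_le_of_le_ofReal zero_le_one
        (by rw [ENNReal.ofReal_one]; exact (measure_mono (Set.subset_univ _)).trans hprob)
    have hle : max 1 ((n : ℝ) * (vertexLaw d α n B).toReal) ≤ (n : ℝ) + 1 := by
      have hn0 : (0 : ℝ) ≤ n := n.cast_nonneg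
      refine max_le (by linarith) ?_
      nlinarith
    refine hle.trans ?_
    have h1 : F n ≤ 1 + K + ∑ i ∈ Finset.range n₀, F i := by
      have := Finset.single_le_sum (fun i _ => hF i) (Finset.mem_range.2 h)
      linarith
    have h2 : (n : ℝ) + 1 = F n * (Real.exp (α * ((d : ℝ) - 1) * omegaSeq d n) * 1) := by
      simp only [F]
      rw [mul_one, mul_assoc, ← Real.exp_add, neg_add_cancel, Real.exp_zero, mul_one]
    rw [h2]
    exact mul_le_mul h1 (mul_le_mul_of_nonneg_left hu1 (Real.exp_pos _).le) (by positivity)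
      (by linarith)
  · have hR := hn₀ n h
    have hR2 : 2 ≤ radius d n := by
      have := Real.add_one_le_exp (1 : ℝ)
      linarith
    have hω : 0 ≤ omegaSeq d n := by
      refine Real.log_nonneg ?_
      rw [Real.le_log_iff_exp_le (by linarith)]
      exact hR
    have hω1 : 1 ≤ Real.exp (α * ((d : ℝ) - 1) * omegaSeq d n) :=
      Real.one_le_exp (mul_nonneg (mul_nonneg (by linarith) (by linarith)) hω)
    have hq : (vertexLaw d α n B).toReal ≤ K * Real.exp ((u - radius d n) / 2) ^ (d - 1) :=
      ENNReal.toReal_le_of_le_ofReal (by positivity) (hball n u hR2 hu.le huR.le)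
    have hnq : (n : ℝ) * (vertexLaw d α n B).toReal ≤
        K * Real.exp (1 / 2 * ((d : ℝ) - 1) * u) := by
      have h1 : Real.exp (1 / 2 * ((d : ℝ) - 1) * u) = Real.exp (radius d n / 2) ^ (d - 1) *
          Real.exp ((u - radius d n) / 2) ^ (d - 1) := by
        rw [← mul_pow, ← Real.exp_add, ← Real.exp_nat_mul, Nat.cast_sub (by omega)]
        congr 1
        push_cast
        ring
      rw [h1, exp_radius_half_pow hd hn]
      calc (n : ℝ) * (vertexLaw d α n B).toReal ≤
          n * (K * Real.exp ((u - radius d n) / 2) ^ (d - 1)) := by gcongr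
        _ = _ := by ring
    have h2 : Real.exp (1 / 2 * ((d : ℝ) - 1) * u) ≤
        Real.exp (α * ((d : ℝ) - 1) * omegaSeq d n) * Real.exp (1 / 2 * ((d : ℝ) - 1) * u) :=
      le_mul_of_one_le_left (Real.exp_pos _).le hω1
    have h3 : max 1 ((n : ℝ) * (vertexLaw d α n B).toReal) ≤
        (1 + K) * Real.exp (1 / 2 * ((d : ℝ) - 1) * u) := max_le (by nlinarith) (by nlinarith)
    exact h3.trans (mul_le_mul (by linarith) h2 (Real.exp_pos _).le (by positivity))

end HypStar

theorem proposition2p3 (d k : ℕ) (hd : 2 ≤ d) (hk : 2 ≤ k) (α : ℝ)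
    (hα : 1 / 2 < α) (hαk : α < (k : ℝ) - 1) :
    ∃ C : ℝ, 0 < C ∧
      ∀ n : ℕ, 1 ≤ n →
      ∀ (Ω : Type*) [MeasurableSpace Ω] (P : Measure Ω) [IsProbabilityMeasure P]
        (X : ℕ → Ω → EuclideanSpace ℝ (Fin d)) (N : Ω → ℕ),
        HypStar.IsPoissonData d α n P X N →
        ∀ u : ℝ, 0 < u → u < HypStar.radius d n →
          MemLp (HypStar.starCountAt k n X N u) 2 P ∧
          variance (HypStar.starCountAt k n X N u) P ≤
            C * Real.exp (α * ((d : ℝ) - 1) * (2 * (k : ℝ) - 3) * HypStar.omegaSeq d n) *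
              Real.exp (1 / 2 * ((d : ℝ) - 1) * (2 * (k : ℝ) - 3) * u) := by
  open HypStar in
  obtain ⟨A, hA, hint⟩ := exists_intensity_le d hd hα
  set m := k - 1 with hm
  set Q : ℝ := ((∑ i ∈ Finset.range m, m.choose i * m.descFactorial (m - i) : ℕ) : ℝ) with hQ
  have hQ0 : 0 ≤ Q := Nat.cast_nonneg _
  refine ⟨(Q + 1) * A ^ (2 * m - 1), by positivity, fun n hn Ω _ P _ X N hdata u hu huR => ?_⟩
  set B := {x | hypDist x (polarPoint d (radius d n) u 0) ≤ radius d n}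
  have hB : MeasurableSet B := measurableSet_le (measurable_hypDist _) measurable_const
  have hprob : IsProbabilityMeasure (vertexLaw d α n) := by
    rw [← hdata.map_X 0]
    exact Measure.isProbabilityMeasure_map (hdata.measurable_X 0).aemeasurable
  have hbound := hint n hn measure_univ.le u hu huR
  set q := (vertexLaw d α n B).toNNReal with hq
  have hqB : ∀ i, P (X i ⁻¹' B) = (q : ENNReal) := fun i => by
    rw [← Measure.map_apply (hdata.measurable_X i) hB, hdata.map_X i, hq,
      ENNReal.coe_toNNReal (measure_ne_top _ _)]
  set Z : Ω → ℕ := fun ω => hitCount B (N ω) fun i => X i ω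
  have hZ : Measurable Z :=
    measurable_hitCount_comp hB hdata.measurable_X hdata.measurable_N
  have hmom : ∀ a : ℕ, ∫⁻ ω, ((Z ω).descFactorial a : ENNReal) ∂P =
      (((n : NNReal) * q : NNReal) : ENNReal) ^ a := fun a => by
    rw [lintegral_descFactorial_hitCount_poisson hdata.measurable_X hdata.iIndepFun_X
      hdata.measurable_N hdata.map_N hdata.indepFun_N_X hB hqB a, ENNReal.coe_mul]
  have hae : starCountAt k n X N u =ᵐ[P] fun ω => ((Z ω).descFactorial m : ℝ) := by
    have hatom : ∀ i x, P.map (X i) {x} = 0 := fun i x => by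
      rw [hdata.map_X i, vertexLaw_singleton (by omega)]
    filter_upwards [ae_injective_of_iIndepFun hdata.measurable_X hdata.iIndepFun_X hatom] with ω hω
    exact starCountAt_eq_of_injective k n X N u ω hω
  set L : ℝ := A * (Real.exp (α * ((d : ℝ) - 1) * omegaSeq d n) *
          Real.exp (1 / 2 * ((d : ℝ) - 1) * u)) with hL
  have hlL : (((n : NNReal) * q : NNReal) : ℝ) ≤ L := by
    refine le_trans (le_of_eq ?_) ((le_max_right _ _).trans hbound)
    push_cast
    rfl
  obtain ⟨hLp, hvar⟩ := memLp_and_variance_descFactorial_le hZ hmom (m := m) hlL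
    ((le_max_left _ _).trans hbound)
  refine ⟨(memLp_congr_ae hae).2 hLp, ?_⟩
  rw [variance_congr hae]
  refine hvar.trans ?_
  have hexp : ((2 * m - 1 : ℕ) : ℝ) = 2 * (k : ℝ) - 3 := by
    rw [hm, Nat.cast_sub (by omega), Nat.cast_mul, Nat.cast_sub (by omega)]
    push_cast
    ring
  have hLpow : L ^ (2 * m - 1) = A ^ (2 * m - 1) *
      Real.exp (α * ((d : ℝ) - 1) * (2 * (k : ℝ) - 3) * omegaSeq d n) *
      Real.exp (1 / 2 * ((d : ℝ) - 1) * (2 * (k : ℝ) - 3) * u) := by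
    rw [hL, mul_pow, mul_pow, ← Real.exp_nat_mul, ← Real.exp_nat_mul, hexp, ← mul_assoc]
    congr 1
    · congr 2
      ring
    · congr 1
      ring
  rw [hLpow, ← hQ, mul_assoc (Q + 1), mul_assoc (Q + 1)]
  gcongr
  linarith
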